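/- Let $\Gamma$ be a countably infinite discrete group. For $f=\sum_{\gamma}f_\gamma\cdot\gamma\in\mathbb{Z}\Gamma$ let $$X_f=\Bigl\{x\in\mathbb{T}^\Gamma:\ \sum_{\gamma\in\Gamma}f_\gamma\,x_{\gamma'\gamma}=0\ \text{ for every }\gamma'\in\Gamma\Bigr\},\qquad \mathbb{T}=\mathbb{R}/\mathbb{Z},$$ a compact abelian group, and let $\alpha_f$ be the action of $\Gamma$ on $X_f$ by continuous automorphisms given by $(\alpha_f^\gamma x)_{\gamma'}=x_{\gamma^{-1}\gamma'}$ (the principal algebraic $\Gamma$-action defined by $f$). For $h=\sum_\gamma h_\gamma\cdot\gamma\in\mathbb{C}\Gamma$ let $\tilde\rho^h$ be the operator on $\ell^2(\Gamma,\mathbb{C})$ given by $(\tilde\rho^h v)_{\gamma'}=\sum_{\gamma}h_\gamma v_{\gamma'\gamma}$, and put $h^*=\sum_\gamma\overline{h_{\gamma^{-1}}}\cdot\gamma$. We say that $\Gamma$ satisfies Linnell's analytic zero-divisor conjecture if $\ker\tilde\rho^{f^*}=\{0\}$ for every nonzero $f\in\mathbb{C}\Gamma$. Suppose that $\Gamma$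 is torsion-free (no element other than the identity has finite order), is not virtually cyclic (has no cyclic subgroup of finite index), and satisfies Linnell's analytic zero-divisor conjecture. Then, for every $f\in\mathbb{Z}\Gamma$ (including $f=0$, where $X_0=\mathbb{T}^\Gamma$ and $\alpha_0$ is the left shift action), the action $\alpha_f$ is ergodic with respect to the normalized Haar measure of $X_f$. -/

import Mathlib

open MeasureTheory

/-- A group is virtually cyclic if it has a cyclic subgroup of finite index. -/
def IsVirtuallyCyclic (Γ : Type*) [Group Γ] : Prop :=
  ∃ H : Subgroup Γ, IsCyclic H ∧ H.FiniteIndex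

/-- A group is torsion-free if its only element of finite order is the identity.
(For noncommutative groups this is weaker than `IsMulTorsionFree`, which asks for unique roots.) -/
def IsTorsionFreeGroup (Γ : Type*) [Group Γ] : Prop :=
  ∀ γ : Γ, IsOfFinOrder γ → γ = 1

section AnalyticZeroDivisor

variable {Γ : Type*} [Group Γ]

/-- The adjoint `h*` of an element `h` of the complex group ring: `h*_γ` is the complex conjugate
of `h_{γ⁻¹}`. -/
noncomputable def groupRingAdjoint (h : MonoidAlgebra ℂ Γ) : MonoidAlgebra ℂ Γ :=
  h.coeff.sum fun γ c => MonoidAlgebra.single γ⁻¹ (starRingEnd ℂ c)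

theorem groupRingAdjoint_coeff (h : MonoidAlgebra ℂ Γ) (γ : Γ) :
    (groupRingAdjoint h).coeff γ = starRingEnd ℂ (h.coeff γ⁻¹) := by
  classical
  simp only [groupRingAdjoint, Finsupp.sum, MonoidAlgebra.coeff_sum, MonoidAlgebra.coeff_single,
    Finsupp.finsetSum_apply, Finsupp.single_apply, inv_eq_iff_eq_inv]
  simp +contextual [Finset.sum_ite_eq']

theorem memLp_rightTranslate (γ : Γ) (v : lp (fun _ : Γ => ℂ) 2) :
    Memℓp (fun γ' : Γ => v (γ' * γ)) 2 := by
  have h := lp.memℓp v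
  rw [memℓp_gen_iff (by norm_num)] at h ⊢
  exact h.comp_injective (mul_left_injective γ)

/-- Right translation on `ℓ²(Γ, ℂ)`: the vector `v` is sent to `γ' ↦ v_{γ' γ}`. -/
noncomputable def rightTranslation (γ : Γ) :
    lp (fun _ : Γ => ℂ) 2 →ₗ[ℂ] lp (fun _ : Γ => ℂ) 2 where
  toFun v := ⟨fun γ' => v (γ' * γ), memLp_rightTranslate γ v⟩
  map_add' _ _ := rfl
  map_smul' _ _ := rfl

/-- The operator `∑_γ h_γ • (right translation by γ)` on `ℓ²(Γ, ℂ)`. -/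
noncomputable def rightRegular (h : MonoidAlgebra ℂ Γ) :
    lp (fun _ : Γ => ℂ) 2 →ₗ[ℂ] lp (fun _ : Γ => ℂ) 2 :=
  h.coeff.sum fun γ c => c • rightTranslation γ

variable (Γ) in
/-- The statement of Linnell's analytic zero-divisor conjecture for the group `Γ`:
for every nonzero `f` in the complex group ring, the operator on `ℓ²(Γ, ℂ)` given by `f*` acting
through right translations is injective. -/
def SatisfiesAnalyticZeroDivisorConjecture : Prop :=
  ∀ f : MonoidAlgebra ℂ Γ, f ≠ 0 → LinearMap.ker (rightRegular (groupRingAdjoint f)) = ⊥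

end AnalyticZeroDivisor

section PrincipalAction

variable {Γ : Type*} [Group Γ]

/-- The left shift on `𝕋^Γ`: `(λ^γ x)_{γ'} = x_{γ⁻¹ γ'}`. -/
def leftShift (γ : Γ) : (Γ → UnitAddCircle) →+ (Γ → UnitAddCircle) where
  toFun x := fun γ' => x (γ⁻¹ * γ')
  map_zero' := rfl
  map_add' _ _ := rfl

/-- The right shift on `𝕋^Γ`: `(ρ^γ x)_{γ'} = x_{γ' γ}`. -/
def rightShift (γ : Γ) : (Γ → UnitAddCircle) →+ (Γ → UnitAddCircle) where
  toFun x := fun γ' => x (γ' * γ)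
  map_zero' := rfl
  map_add' _ _ := rfl

/-- `ρ^f = ∑_γ f_γ ρ^γ` for `f` in the integral group ring. -/
noncomputable def rightShiftRing (f : MonoidAlgebra ℤ Γ) :
    (Γ → UnitAddCircle) →+ (Γ → UnitAddCircle) :=
  f.coeff.sum fun γ n => n • rightShift γ

theorem rightShiftRing_apply (f : MonoidAlgebra ℤ Γ) (x : Γ → UnitAddCircle) (γ' : Γ) :
    rightShiftRing f x γ' = f.coeff.sum fun γ n => n • x (γ' * γ) := by
  simp [rightShiftRing, Finsupp.sum, rightShift]

/-- The compact abelian group `X_f = ker ρ^f ⊆ 𝕋^Γ`. -/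
noncomputable def principalGroup (f : MonoidAlgebra ℤ Γ) : AddSubgroup (Γ → UnitAddCircle) :=
  (rightShiftRing f).ker

theorem leftShift_mem_principalGroup (f : MonoidAlgebra ℤ Γ) (γ : Γ) {x : Γ → UnitAddCircle}
    (hx : x ∈ principalGroup f) : leftShift γ x ∈ principalGroup f := by
  rw [principalGroup, AddMonoidHom.mem_ker] at hx ⊢
  funext γ'
  have h := congrFun hx (γ⁻¹ * γ')
  rw [rightShiftRing_apply] at h ⊢
  simpa [leftShift, mul_assoc] using h

/-- The principal algebraic action `α_f`: the restriction of the left shift action to `X_f`. -/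
instance principalAction (f : MonoidAlgebra ℤ Γ) : DistribMulAction Γ (principalGroup f) where
  smul γ x := ⟨leftShift γ x, leftShift_mem_principalGroup f γ x.2⟩
  one_smul x := Subtype.ext <| funext fun γ' => by
    change x.1 (1⁻¹ * γ') = x.1 γ'
    simp
  mul_smul γ δ x := Subtype.ext <| funext fun γ' => by
    change x.1 ((γ * δ)⁻¹ * γ') = x.1 (δ⁻¹ * (γ⁻¹ * γ'))
    simp [mul_assoc]
  smul_zero _ := rfl
  smul_add _ _ _ := rfl

theorem principalAction_apply (f : MonoidAlgebra ℤ Γ) (γ γ' : Γ) (x : principalGroup f) :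
    (γ • x : principalGroup f).1 γ' = x.1 (γ⁻¹ * γ') := rfl

instance principalAction_continuous (f : MonoidAlgebra ℤ Γ) :
    ContinuousConstSMul Γ (principalGroup f) where
  continuous_const_smul γ := by
    refine Continuous.subtype_mk (continuous_pi fun γ' => ?_) _
    exact (continuous_apply (γ⁻¹ * γ')).comp continuous_subtype_val

theorem isClosed_principalGroup (f : MonoidAlgebra ℤ Γ) :
    IsClosed (principalGroup f : Set (Γ → UnitAddCircle)) := by
  have h : (principalGroup f : Set (Γ → UnitAddCircle)) = (fun x => rightShiftRing f x) ⁻¹' {0} := rfl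
  rw [h]
  refine isClosed_singleton.preimage (continuous_pi fun γ' => ?_)
  simp only [rightShiftRing_apply, Finsupp.sum]
  fun_prop

instance principalGroup_compactSpace (f : MonoidAlgebra ℤ Γ) : CompactSpace (principalGroup f) :=
  isCompact_iff_compactSpace.mp (isClosed_principalGroup f).isCompact

/-- The Haar measure of the compact group `X_f`, normalized to total mass one. -/
noncomputable def principalHaar [Countable Γ] (f : MonoidAlgebra ℤ Γ) :
    Measure (principalGroup f) :=
  Measure.addHaarMeasure ⊤

instance principalHaar_isProbabilityMeasure [Countable Γ] (f : MonoidAlgebra ℤ Γ) :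
    IsProbabilityMeasure (principalHaar f) :=
  ⟨by simpa [principalHaar] using Measure.addHaarMeasure_self (K₀ := (⊤ : TopologicalSpace.PositiveCompacts (principalGroup f)))⟩

end PrincipalAction

/-! By Pontryagin duality and Bessel's inequality, ergodicity follows once every character of X_f
with stabilizer K of finite index is trivial (`ergodicSMul_of_forall_finiteIndex`). Such a character
is given by h with γh - h = c(γ)f for γ in K, and one must find k with h = kf. For f ≠ 0 the
zero-divisor hypothesis makes c unique, hence a cocycle; it is the coboundary of a function b : Γ →
ℤ that each element of K changes at only finitely many points.

Fix γ ≠ 1 in K. Being integer-valued, b is eventually constant at both ends of each γ-orbit. If the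
two limits always agree, b is a finitely supported k plus a γ-invariant function, and (γ - 1)(h -
kf) = 0 forces h = kf.

Otherwise b separates two ends. If K commensurated ⟨γ⟩, then ⟨γ⟩ would have finite index; so some g
in K does not, and level sets of translates of b give four disjoint sets as in ping-pong
(`exists_paradoxical_sets`), hence a spectral gap. The gap and the injectivity of f* on ℓ² turn
c(γ^m), for some m ≠ 0, into the coboundary of an ℓ² vector x (`exists_eq_coboundary`). Then x - b
is constant on γ^m-orbits while x vanishes at infinity, so the two limits agree after all. -/

/-! ### Eventual behaviour along the integers -/

open Filter in
theorem tendsto_zpow_mul_cofinite {G : Type*} [Group G] {γ : G}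
    (hγ : Function.Injective fun n : ℤ => γ ^ n) (k z : G) :
    Tendsto (fun n : ℤ => k * γ ^ n * z) cofinite cofinite :=
  Function.Injective.tendsto_cofinite fun m n h => hγ (by simpa using h)

open Filter in
theorem int_atTop_le_cofinite : (atTop : Filter ℤ) ≤ cofinite := by
  rw [Int.cofinite_eq]; exact le_sup_right

open Filter in
theorem int_atBot_le_cofinite : (atBot : Filter ℤ) ≤ cofinite := by
  rw [Int.cofinite_eq]; exact le_sup_left

open Filter in
/-- A function on the integers that is eventually invariant under the shift is eventually
constant. -/
theorem eventually_eq_const_atTop {α : Type*} {u : ℤ → α}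
    (h : ∀ᶠ n in atTop, u (n + 1) = u n) : ∃ p, ∀ᶠ n in atTop, u n = p := by
  obtain ⟨N, hN⟩ := eventually_atTop.1 h
  refine ⟨u N, eventually_atTop.2 ⟨N, fun n hn => ?_⟩⟩
  induction n, hn using Int.leInduction with
  | base => rfl
  | succ n hn ih => rw [hN n hn, ih]

open Filter in
theorem eventually_eq_const_atBot {α : Type*} {u : ℤ → α}
    (h : ∀ᶠ n in atBot, u (n + 1) = u n) : ∃ p, ∀ᶠ n in atBot, u n = p := by
  obtain ⟨N, hN⟩ := eventually_atBot.1 h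
  refine ⟨u N, eventually_atBot.2 ⟨N, fun n hn => ?_⟩⟩
  induction n, hn using Int.leInductionDown with
  | base => rfl
  | pred n hn ih => rw [← ih, ← hN (n - 1) (by omega), sub_add_cancel]

-- A negative factor swaps the two ends of ℤ; asking only for some filter hides the sign of r from
-- later arguments.
open Filter in
theorem exists_tendsto_const_mul_int {r : ℤ} (hr : r ≠ 0) :
    (∃ l : Filter ℤ, l.NeBot ∧ Tendsto (fun j : ℤ => r * j) l atTop) ∧
      ∃ l : Filter ℤ, l.NeBot ∧ Tendsto (fun j : ℤ => r * j) l atBot := by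
  have key : ∀ r : ℤ, 0 < r → Tendsto (fun j : ℤ => r * j) atTop atTop ∧
      Tendsto (fun j : ℤ => r * j) atBot atBot := fun r h =>
    ⟨tendsto_id.const_mul_atTop' h, by
      simpa [Function.comp_def] using tendsto_neg_atTop_atBot.comp
        ((tendsto_neg_atBot_atTop (G := ℤ)).const_mul_atTop' h)⟩
  rcases lt_or_gt_of_ne hr with h | h
  · obtain ⟨h1, h2⟩ := key (-r) (neg_pos.2 h)
    refine ⟨⟨atBot, inferInstance, ?_⟩, ⟨atTop, inferInstance, ?_⟩⟩
    · simpa [Function.comp_def] using h1.comp tendsto_neg_atBot_atTop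
    · simpa [Function.comp_def] using h2.comp tendsto_neg_atTop_atBot
  · exact ⟨⟨atTop, inferInstance, (key r h).1⟩, ⟨atBot, inferInstance, (key r h).2⟩⟩

/-- `g` commensurates the cyclic group generated by `γ`. -/
def Commensurates {G : Type*} [Group G] (γ g : G) : Prop :=
  ∃ r s : ℤ, r ≠ 0 ∧ s ≠ 0 ∧ g * γ ^ r = γ ^ s * g

/-! ### Almost invariant functions, ends and paradoxical sets -/

section AlmostInvariant

open Filter

variable {G : Type*} [Group G] {γ : G} {b : G → ℤ}

theorem exists_limit_atTop (hγ : Function.Injective fun n : ℤ => γ ^ n)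
    (hb : ∀ᶠ z in cofinite, b (γ * z) = b z) (z : G) :
    ∃ p, ∀ᶠ n : ℤ in atTop, b (γ ^ n * z) = p := by
  refine eventually_eq_const_atTop ?_
  filter_upwards [int_atTop_le_cofinite ((tendsto_zpow_mul_cofinite hγ 1 z).eventually hb)]
    with n hn
  rw [add_comm, zpow_one_add, mul_assoc]
  simpa using hn

theorem exists_limit_atBot (hγ : Function.Injective fun n : ℤ => γ ^ n)
    (hb : ∀ᶠ z in cofinite, b (γ * z) = b z) (z : G) :
    ∃ p, ∀ᶠ n : ℤ in atBot, b (γ ^ n * z) = p := by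
  refine eventually_eq_const_atBot ?_
  filter_upwards [int_atBot_le_cofinite ((tendsto_zpow_mul_cofinite hγ 1 z).eventually hb)]
    with n hn
  rw [add_comm, zpow_one_add, mul_assoc]
  simpa using hn

theorem eventually_mul_zpow_mul {l : Filter ℤ} (hl : l ≤ cofinite)
    (hγ : Function.Injective fun n : ℤ => γ ^ n) {g : G}
    (hb : ∀ᶠ z in cofinite, b (g * z) = b z) {p : ℤ} {z : G}
    (h : ∀ᶠ n in l, b (γ ^ n * z) = p) : ∀ᶠ n in l, b (g * γ ^ n * z) = p := by
  filter_upwards [h, hl ((tendsto_zpow_mul_cofinite hγ 1 z).eventually hb)] with n h1 h2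
  rw [← h1, mul_assoc]
  simpa using h2

/-- Away from the `γ`-orbits of the points where `b` is not `γ`-invariant, `b` is constant on
`γ`-orbits. -/
theorem apply_zpow_mul_eq {α : Type*} {b : G → α} {w : G} (h : ∀ j : ℤ, b (γ * (γ ^ j * w)) = b (γ ^ j * w)) (j : ℤ) :
    b (γ ^ j * w) = b w := by
  induction j using Int.induction_on with
  | zero => simp
  | succ n ih => rw [← ih, ← h n, ← mul_assoc γ, ← zpow_one_add, add_comm]
  | pred n ih => rw [← ih, ← h (-n - 1), ← mul_assoc γ, ← zpow_one_add]; congr 3; ring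

/-- Pigeonhole: if infinitely many n failed, two of them would hit the same point of F, and
cancelling z gives a relation g γ^r = γ^s g with r ≠ 0, so also s ≠ 0. -/
theorem eventually_forall_notMem (hγ : Function.Injective fun n : ℤ => γ ^ n) {g : G}
    (hg : ¬ Commensurates γ g) {F : Set G} (hF : F.Finite) (z : G) :
    ∀ᶠ n : ℤ in cofinite, ∀ j : ℤ, γ ^ j * (g * γ ^ n * z) ∉ F := by
  by_contra hcon
  have hinf : {n : ℤ | ∃ j : ℤ, γ ^ j * (g * γ ^ n * z) ∈ F}.Infinite := by
    rw [eventually_cofinite] at hcon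
    simpa only [Set.Infinite, not_forall, not_not] using hcon
  choose! j hj using fun n (hn : n ∈ {n : ℤ | ∃ j : ℤ, γ ^ j * (g * γ ^ n * z) ∈ F}) => hn
  obtain ⟨m, -, n, -, hmn, he⟩ := hinf.exists_ne_map_eq_of_mapsTo
    (f := fun n => γ ^ j n * (g * γ ^ n * z)) hj hF
  have he' : g * γ ^ (m - n) = γ ^ (j n - j m) * g := by
    have : γ ^ j m * (g * γ ^ m) = γ ^ j n * (g * γ ^ n) := by
      simpa [← mul_assoc] using he
    rw [zpow_sub, zpow_sub, ← (Commute.zpow_zpow_self γ (j m) (j n)).inv_left.eq, ← mul_assoc,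
      mul_inv_eq_iff_eq_mul, mul_assoc, mul_assoc, eq_inv_mul_iff_mul_eq, this]
  refine hg ⟨m - n, j n - j m, sub_ne_zero.2 hmn, fun h0 => ?_, he'⟩
  rw [h0, zpow_zero, one_mul] at he'
  have : γ ^ (m - n) = γ ^ (0 : ℤ) := by simpa using he'
  exact sub_ne_zero.2 hmn (hγ this)

/-- If `g` does not commensurate `γ`, far out along a `γ`-orbit translated by `g` the function `b`
is constant along `γ`-orbits. -/
theorem eventually_forall_apply_eq {l : Filter ℤ} (hl : l ≤ cofinite)
    (hγ : Function.Injective fun n : ℤ => γ ^ n) {g : G} (hg : ¬ Commensurates γ g)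
    (hbγ : ∀ᶠ z in cofinite, b (γ * z) = b z) (hbg : ∀ᶠ z in cofinite, b (g * z) = b z) {p : ℤ}
    {z : G} (h : ∀ᶠ n in l, b (γ ^ n * z) = p) :
    ∀ᶠ n in l, ∀ j : ℤ, b (γ ^ j * (g * γ ^ n * z)) = p := by
  filter_upwards [hl (eventually_forall_notMem hγ hg (eventually_cofinite.1 hbγ) z),
    eventually_mul_zpow_mul hl hγ hbg h] with n h1 h2 j
  rw [← h2]
  exact apply_zpow_mul_eq (fun i => by simpa using h1 i) j

/-- If two sets `P`, `Q` are such that no boundary edge of either one meets the other, then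
`P ∩ Q` is invariant under left multiplication. -/
theorem disjoint_of_boundary {S : Set G} (hS : Subgroup.closure S = ⊤) {P Q : Set G}
    (hP : ∀ s ∈ S, ∀ z, ¬ (s * z ∈ P ↔ z ∈ P) → z ∉ Q ∧ s * z ∉ Q)
    (hQ : ∀ s ∈ S, ∀ z, ¬ (s * z ∈ Q ↔ z ∈ Q) → z ∉ P ∧ s * z ∉ P)
    (h1 : (1 : G) ∉ P) : Disjoint P Q := by
  -- An edge leaving P or Q has both endpoints outside P ∩ Q, and any other edge preserves both
  -- memberships. Hence P ∩ Q is everything or empty, and 1 decides.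
  have key : ∀ k ∈ Subgroup.closure S, ∀ z, k * z ∈ P ∩ Q ↔ z ∈ P ∩ Q := by
    intro k hk
    induction hk using Subgroup.closure_induction with
    | mem s hs =>
      intro z
      have := hP s hs z
      have := hQ s hs z
      simp only [Set.mem_inter_iff]
      tauto
    | one => simp
    | mul x y _ _ hx hy => intro z; rw [mul_assoc, hx, hy]
    | inv x _ hx => intro z; rw [← hx (x⁻¹ * z), mul_inv_cancel_left]
  rw [Set.disjoint_iff]
  intro z hz
  have := (key z (hS ▸ trivial) 1).1 (by simpa using hz)
  exact h1 this.1

/-- The set of points whose right translate by `t` has a value of `b` different from `p`. -/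
def translateSet (b : G → ℤ) (t : G) (p : ℤ) : Set G := {z | b (z * t) ≠ p}

/-- Boundary edges of `translateSet b t p` are the jump edges of b moved by t⁻¹ on the right. With k
= z t one has z t' = k (t⁻¹ t'), so the hypotheses say that each set avoids the boundary of the
other. -/
theorem disjoint_translateSet {S : Set G} (hS : Subgroup.closure S = ⊤)
    {t t' : G} {p p' : ℤ}
    (h : ∀ s ∈ S, ∀ k, b (s * k) ≠ b k →
      b (k * (t⁻¹ * t')) = p' ∧ b (s * k * (t⁻¹ * t')) = p')
    (h' : ∀ s ∈ S, ∀ k, b (s * k) ≠ b k →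
      b (k * (t'⁻¹ * t)) = p ∧ b (s * k * (t'⁻¹ * t)) = p)
    (h1 : b t = p) : Disjoint (translateSet b t p) (translateSet b t' p') := by
  refine disjoint_of_boundary hS ?_ ?_ (by simpa [translateSet] using h1)
  · intro s hs z hz
    have := h s hs (z * t) (fun he => hz (by simp only [translateSet, Set.mem_ofPred_eq,
      mul_assoc, he]))
    simpa [translateSet, mul_assoc] using this
  · intro s hs z hz
    have := h' s hs (z * t') (fun he => hz (by simp only [translateSet, Set.mem_ofPred_eq,
      mul_assoc, he]))
    simpa [translateSet, mul_assoc] using this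

/-- Only finitely many edges are jumps of b, and left multiplication by each of kx and skx does not
affect the limit p. -/
theorem eventually_boundary {l : Filter ℤ} (hl : l ≤ cofinite)
    (hγ : Function.Injective fun n : ℤ => γ ^ n) (hb : ∀ k, ∀ᶠ z in cofinite, b (k * z) = b z)
    {S : Set G} (hS : S.Finite) {p : ℤ} (x : G) {z : G} (h : ∀ᶠ n in l, b (γ ^ n * z) = p) :
    ∀ᶠ n in l, ∀ s ∈ S, ∀ k, b (s * k) ≠ b k →
      b (k * (x * γ ^ n * z)) = p ∧ b (s * k * (x * γ ^ n * z)) = p := by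
  refine (eventually_all_finite hS).2 fun s _ => ?_
  refine (eventually_all_finite (I := {k | b (s * k) ≠ b k}) (eventually_cofinite.1 (hb s))).2
    fun k _ => ?_
  filter_upwards [eventually_mul_zpow_mul hl hγ (hb (k * x)) h,
    eventually_mul_zpow_mul hl hγ (hb (s * k * x)) h] with n h1 h2
  exact ⟨by simpa only [mul_assoc] using h1, by simpa only [mul_assoc] using h2⟩

/-- The sets compare b, translated by γ^{±m} and g⁻¹γ^{±n}, with its end values p and q. Since p ≠
q, a point where one translate equals p lies in the set attached to q after a shift. -/
theorem exists_paradoxical_sets {g : G} (hS : Subgroup.closure {γ, g} = ⊤)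
    (hγ : Function.Injective fun n : ℤ => γ ^ n) (hb : ∀ k, ∀ᶠ z in cofinite, b (k * z) = b z)
    (hg : ¬ Commensurates γ g) {p q : ℤ} (hpq : p ≠ q)
    (hp : ∀ᶠ n : ℤ in atTop, b (γ ^ n) = p) (hq : ∀ᶠ n : ℤ in atBot, b (γ ^ n) = q) :
    ∃ m n : ℤ, m ≠ 0 ∧ ∃ P P' Q Q' : Set G, Disjoint P P' ∧ Disjoint Q Q' ∧
      Disjoint P Q ∧ Disjoint P Q' ∧ Disjoint P' Q ∧ Disjoint P' Q' ∧
      (∀ z ∉ P', z * γ ^ m ∈ P) ∧ ∀ z ∉ Q', z * (g⁻¹ * γ ^ n * g) ∈ Q := by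
  have hp1 : ∀ᶠ n : ℤ in atTop, b (γ ^ n * 1) = p := by simpa using hp
  have hq1 : ∀ᶠ n : ℤ in atBot, b (γ ^ n * 1) = q := by simpa using hq
  have hneg : Tendsto (fun n : ℤ => -n) atTop atBot := tendsto_neg_atTop_atBot
  have hdbl : Tendsto (fun n : ℤ => n + n) atTop atTop :=
    tendsto_id.atTop_add_atTop tendsto_id
  have hT := int_atTop_le_cofinite
  have hB := int_atBot_le_cofinite
  have bT := fun x : G => eventually_boundary hT hγ hb (Set.toFinite {γ, g}) x hp1
  have bB := fun x : G => eventually_boundary hB hγ hb (Set.toFinite {γ, g}) x hq1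
  -- Here m is fixed first, so large that b is constant on the whole γ-orbits of gγ^m and gγ^{-m}.
  -- This is where non-commensuration enters: it controls γ^{±n} g γ^{±m} as n grows, whatever the
  -- sign of n.
  obtain ⟨m, hm0, hm1, hm2, hm3, hm4, hm5, hm6⟩ :=
    ((eventually_gt_atTop 0).and <| (hdbl.eventually (bT 1)).and <|
      ((hneg.comp hdbl).eventually (bB 1)).and <|
      (hneg.eventually (eventually_forall_apply_eq hB hγ hg (hb γ) (hb g) hq1)).and <|
      (eventually_forall_apply_eq hT hγ hg (hb γ) (hb g) hp1).and <|
      (hneg.eventually hq).and hp).exists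
  have bq := eventually_boundary hT hγ hb (Set.toFinite {γ, g}) 1 (.of_forall hm3)
  have bq' := eventually_boundary hB hγ hb (Set.toFinite {γ, g}) 1 (.of_forall hm3)
  have bp := eventually_boundary hT hγ hb (Set.toFinite {γ, g}) 1 (.of_forall hm4)
  have bp' := eventually_boundary hB hγ hb (Set.toFinite {γ, g}) 1 (.of_forall hm4)
  obtain ⟨n, hn1, hn2, hn3, hn4, hn5, hn6, hn7, hn8, hn9, hn10, hn11⟩ :=
    ((hdbl.eventually (bT 1)).and <| ((hneg.comp hdbl).eventually (bB 1)).and <|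
      bq.and <| (hneg.eventually bq').and <| bp.and <| (hneg.eventually bp').and <|
      (bT (γ ^ m * g⁻¹)).and <| (hneg.eventually (bB (γ ^ m * g⁻¹))).and <|
      (bT (γ ^ (-m) * g⁻¹)).and <| (hneg.eventually (bB (γ ^ (-m) * g⁻¹))).and <|
      hneg.eventually (eventually_mul_zpow_mul hB hγ (hb g⁻¹) hq1)).exists
  have e1 : ∀ i : ℤ, (γ ^ (-i))⁻¹ * γ ^ i = 1 * γ ^ (i + i) * 1 := by intro i; group
  have e2 : ∀ i : ℤ, (γ ^ i)⁻¹ * γ ^ (-i) = 1 * γ ^ (-(i + i)) * 1 := by intro i; group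
  have e3 : ∀ i j : ℤ, (γ ^ i)⁻¹ * (g⁻¹ * γ ^ j) = γ ^ (-i) * g⁻¹ * γ ^ j * 1 := by
    intro i j; group
  have e4 : ∀ i j : ℤ, (g⁻¹ * γ ^ j)⁻¹ * γ ^ i = 1 * γ ^ (-j) * (g * γ ^ i * 1) := by
    intro i j; group
  have e5 : ∀ i j : ℤ, (g⁻¹ * γ ^ i)⁻¹ * (g⁻¹ * γ ^ j) = (γ ^ i)⁻¹ * γ ^ j := by
    intro i j; group
  -- The exponents double because the shift carries the translate by γ^{-m} to the one by γ^m.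
  refine ⟨m + m, n + n, by omega, translateSet b (γ ^ (-m)) q, translateSet b (γ ^ m) p,
    translateSet b (g⁻¹ * γ ^ (-n)) q, translateSet b (g⁻¹ * γ ^ n) p,
    disjoint_translateSet hS ?_ ?_ hm5, disjoint_translateSet hS ?_ ?_ (by simpa using hn11),
    disjoint_translateSet hS ?_ ?_ hm5, disjoint_translateSet hS ?_ ?_ hm5,
    disjoint_translateSet hS ?_ ?_ hm6, disjoint_translateSet hS ?_ ?_ hm6, ?_, ?_⟩
  · rwa [e1]
  · rwa [e2]
  · rwa [e5, e1]
  · rwa [e5, e2]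
  · rwa [e3, neg_neg]
  · rwa [e4, neg_neg]
  · rwa [e3, neg_neg]
  · rwa [e4]
  · rwa [e3]
  · rwa [e4, neg_neg]
  · rwa [e3]
  · rwa [e4]
  · intro z hz
    have hz' : b (z * γ ^ m) = p := not_not.1 hz
    have : z * γ ^ (m + m) * γ ^ (-m) = z * γ ^ m := by group
    simpa only [translateSet, Set.mem_ofPred_eq, this, hz'] using hpq
  · intro z hz
    have hz' : b (z * (g⁻¹ * γ ^ n)) = p := not_not.1 hz
    have : z * (g⁻¹ * γ ^ (n + n) * g) * (g⁻¹ * γ ^ (-n)) = z * (g⁻¹ * γ ^ n) := by group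
    simpa only [translateSet, Set.mem_ofPred_eq, this, hz'] using hpq

/-- If every element of `H` commensurates `γ` and `b` has different limits at the two ends of the
`γ`-orbit of `y`, then `H` is covered by finitely many cosets of the group generated by `γ`. -/
theorem exists_finite_cover_of_commensurates (hγ : Function.Injective fun n : ℤ => γ ^ n)
    {H : Subgroup G} (hγH : γ ∈ H) (hb : ∀ k ∈ H, ∀ᶠ z in cofinite, b (k * z) = b z)
    (hH : ∀ g ∈ H, Commensurates γ g) {p q : ℤ} (hpq : p ≠ q) {y : G}
    (hp : ∀ᶠ n : ℤ in atTop, b (γ ^ n * y) = p) (hq : ∀ᶠ n : ℤ in atBot, b (γ ^ n * y) = q) :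
    ∃ F : Set G, F.Finite ∧ ∀ g ∈ H, ∃ j : ℤ, ∃ w ∈ F, g = γ ^ j * w := by
  have hF : {w | b (γ * w) ≠ b w}.Finite := eventually_cofinite.1 (hb γ hγH)
  -- If g lies outside these cosets, the γ-orbit of gy contains no jump of b. Commensuration puts g
  -- γ^{rj} y on that orbit, so b would have the same limit at both ends.
  refine ⟨(· * y⁻¹) '' {w | b (γ * w) ≠ b w}, hF.image _, fun g hg => ?_⟩
  by_contra hcon
  have hw : ∀ j : ℤ, b (γ * (γ ^ j * (g * y))) = b (γ ^ j * (g * y)) := by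
    intro j
    by_contra hj
    exact hcon ⟨-j, _, ⟨_, hj, rfl⟩, by group⟩
  have hconst := fun j : ℤ => apply_zpow_mul_eq hw j
  obtain ⟨r, s, hr, hs, hrs⟩ := hH g hg
  have hpow : ∀ j : ℤ, g * γ ^ (r * j) = γ ^ (s * j) * g := by
    intro j
    have : SemiconjBy g (γ ^ r) (γ ^ s) := hrs
    simpa only [zpow_mul] using (this.zpow_right j).eq
  have lim : ∀ {l l' : Filter ℤ} [l.NeBot] {v : ℤ}, l' ≤ cofinite →
      Tendsto (fun j : ℤ => r * j) l l' → (∀ᶠ n in l', b (γ ^ n * y) = v) → b (g * y) = v := by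
    intro l l' _ v hl' ht hv
    obtain ⟨j, hj⟩ := (ht.eventually (eventually_mul_zpow_mul hl' hγ (hb g hg) hv)).exists
    rw [← hj, hpow, mul_assoc, hconst]
  obtain ⟨⟨l, _, t⟩, l', _, t'⟩ := exists_tendsto_const_mul_int hr
  exact hpq ((lim int_atTop_le_cofinite t hp).symm.trans (lim int_atBot_le_cofinite t' hq))

/-- If `b` has the same limits at the two ends of every `γ`-orbit, it differs from a
`γ`-invariant function by a finitely supported one. -/
theorem exists_finite_support_of_limits_eq
    (hb : ∀ᶠ z in cofinite, b (γ * z) = b z) {q : G → ℤ}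
    (hp : ∀ z, ∀ᶠ n : ℤ in atTop, b (γ ^ n * z) = q z)
    (hq : ∀ z, ∀ᶠ n : ℤ in atBot, b (γ ^ n * z) = q z) :
    (∀ (j : ℤ) z, q (γ ^ j * z) = q z) ∧ {z | b z ≠ q z}.Finite := by
  have hinv : ∀ (j : ℤ) z, q (γ ^ j * z) = q z := by
    intro j z
    obtain ⟨n, h1, h2⟩ := ((hp (γ ^ j * z)).and
      ((tendsto_atTop_add_const_right _ j tendsto_id).eventually (hp z))).exists
    rw [← h1, ← h2, ← mul_assoc, ← zpow_add, id]
  refine ⟨hinv, ?_⟩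
  have hcof : ∀ z, ∀ᶠ n : ℤ in cofinite, b (γ ^ n * z) = q z := by
    intro z
    rw [Int.cofinite_eq, eventually_sup]
    exact ⟨hq z, hp z⟩
  -- An orbit without jumps has b equal to its limit; only finitely many orbits have jumps, and each
  -- contributes finitely many points.
  have hfin : (⋃ w ∈ {w | b (γ * w) ≠ b w},
      (fun j : ℤ => γ ^ j * w) '' {j | b (γ ^ j * w) ≠ q w}).Finite :=
    (eventually_cofinite.1 hb).biUnion fun w _ => (eventually_cofinite.1 (hcof w)).image _
  refine hfin.subset fun z hz => ?_
  by_cases hw : ∀ j : ℤ, b (γ * (γ ^ j * z)) = b (γ ^ j * z)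
  · obtain ⟨n, hn⟩ := (hp z).exists
    exact absurd ((apply_zpow_mul_eq hw n).symm.trans hn) hz
  · push Not at hw
    obtain ⟨j, hj⟩ := hw
    simp only [Set.mem_iUnion]
    refine ⟨γ ^ j * z, hj, -j, ?_, by group⟩
    have : γ ^ (-j) * (γ ^ j * z) = z := by group
    simpa only [Set.mem_ofPred_eq, this, hinv] using hz

end AlmostInvariant

/-! ### Spectral gap and coboundaries in ℓ² -/

section LeftTranslation

variable {Γ : Type*} [Group Γ]

theorem memLp_leftTranslate (γ : Γ) (v : lp (fun _ : Γ => ℂ) 2) :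
    Memℓp (fun γ' : Γ => v (γ * γ')) 2 := by
  have h := lp.memℓp v
  rw [memℓp_gen_iff (by norm_num)] at h ⊢
  exact h.comp_injective (mul_right_injective γ)

/-- Left translation on `ℓ²(Γ, ℂ)`: the vector `v` is sent to `γ' ↦ v_{γ⁻¹ γ'}`. -/
noncomputable def leftTranslation (γ : Γ) :
    lp (fun _ : Γ => ℂ) 2 →ₗᵢ[ℂ] lp (fun _ : Γ => ℂ) 2 where
  toFun v := ⟨fun z => v (γ⁻¹ * z), memLp_leftTranslate γ⁻¹ v⟩
  map_add' _ _ := rfl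
  map_smul' _ _ := rfl
  norm_map' v := by
    rw [lp.norm_eq_tsum_rpow (by norm_num), lp.norm_eq_tsum_rpow (by norm_num)]
    congr 1
    exact (Equiv.mulLeft γ⁻¹).tsum_eq (fun z => ‖v z‖ ^ (2 : ENNReal).toReal)

theorem leftTranslation_apply (γ : Γ) (v : lp (fun _ : Γ => ℂ) 2) (z : Γ) :
    leftTranslation γ v z = v (γ⁻¹ * z) := rfl

theorem leftTranslation_mul (γ δ : Γ) (v : lp (fun _ : Γ => ℂ) 2) :
    leftTranslation γ (leftTranslation δ v) = leftTranslation (γ * δ) v := by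
  ext z
  simp [leftTranslation_apply, mul_assoc]

theorem leftTranslation_one (v : lp (fun _ : Γ => ℂ) 2) : leftTranslation 1 v = v := by
  ext z
  simp [leftTranslation_apply]

theorem inner_leftTranslation_inv (γ : Γ) (v w : lp (fun _ : Γ => ℂ) 2) :
    inner ℂ (leftTranslation γ⁻¹ v) w = inner ℂ v (leftTranslation γ w) := by
  rw [← (leftTranslation γ).inner_map_map, leftTranslation_mul, mul_inv_cancel,
    leftTranslation_one]

theorem hasSum_norm_sq {Γ : Type*} (v : lp (fun _ : Γ => ℂ) 2) : HasSum (fun z => ‖v z‖ ^ 2) (‖v‖ ^ 2) := by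
  simpa using lp.hasSum_norm (p := 2) (by norm_num) v

/-- A paradoxical pair of translations forces a spectral gap. -/
theorem norm_sq_le_of_paradoxical {a d : Γ} {P P' Q Q' : Set Γ} (h1 : Disjoint P P')
    (h2 : Disjoint Q Q') (h3 : Disjoint P Q) (h4 : Disjoint P Q') (h5 : Disjoint P' Q)
    (h6 : Disjoint P' Q') (ha : ∀ z ∉ P', a⁻¹ * z ∈ P) (hd : ∀ z ∉ Q', d⁻¹ * z ∈ Q)
    (v : lp (fun _ : Γ => ℂ) 2) :
    ‖v‖ ^ 2 ≤ 8 * (‖leftTranslation a v - v‖ ^ 2 + ‖leftTranslation d v - v‖ ^ 2) := by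
  classical
  set w : Γ → ℝ := fun z => ‖v z‖ ^ 2
  have hw0 : ∀ z, 0 ≤ w z := fun z => sq_nonneg _
  have hw : HasSum w (‖v‖ ^ 2) := hasSum_norm_sq v
  have key : ∀ (a : Γ) (P P' : Set Γ), (∀ z ∉ P', a⁻¹ * z ∈ P) →
      ‖v‖ ^ 2 ≤ ∑' z, P.indicator w z + ∑' z, P'.indicator w z
        + (‖v‖ ^ 2 / 4 + 4 * ‖leftTranslation a v - v‖ ^ 2) := by
    intro a P P' ha
    have hP := (hw.summable.indicator P).hasSum
    have hP' := (hw.summable.indicator P').hasSum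
    have hPa := (Equiv.mulLeft a⁻¹).hasSum_iff.2 hP
    have hwa := (Equiv.mulLeft a⁻¹).hasSum_iff.2 hw
    have hD := hasSum_norm_sq (leftTranslation a v - v)
    have := hasSum_le (fun z => ?_) hw
      ((hPa.add hP').add (((hw.add hwa).mul_left (1 / 8)).add (hD.mul_left 4)))
    · linarith
    simp only [Function.comp_apply, Equiv.coe_mulLeft, lp.coeFn_sub, Pi.sub_apply,
      leftTranslation_apply]
    -- With s and t the sum and difference of the norms, |st| ≤ s²/16 + 4t². The weights leave a
    -- total loss of ‖v‖²/2 over the two translations, against the gain 2‖v‖² ≤ ‖v‖² + loss.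
    have hdiff : w z - w (a⁻¹ * z) ≤
        1 / 8 * (w z + w (a⁻¹ * z)) + 4 * ‖v (a⁻¹ * z) - v z‖ ^ 2 := by
      have hn := abs_norm_sub_norm_le (v (a⁻¹ * z)) (v z)
      have hs : (‖v (a⁻¹ * z)‖ - ‖v z‖) ^ 2 ≤ ‖v (a⁻¹ * z) - v z‖ ^ 2 :=
        sq_le_sq.2 (by rwa [abs_norm])
      simp only [w]
      nlinarith [sq_nonneg (‖v (a⁻¹ * z)‖ - ‖v z‖), sq_nonneg (‖v (a⁻¹ * z)‖ + ‖v z‖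
        + 8 * (‖v (a⁻¹ * z)‖ - ‖v z‖))]
    by_cases hz : z ∈ P'
    · have := Set.indicator_nonneg (s := P) (fun z _ => hw0 z) (a⁻¹ * z)
      rw [Set.indicator_of_mem hz]
      have := hw0 z
      have := hw0 (a⁻¹ * z)
      have := sq_nonneg ‖v (a⁻¹ * z) - v z‖
      linarith
    · rw [Set.indicator_of_mem (ha z hz), Set.indicator_of_notMem hz]
      linarith
  have hA := key a P P' ha
  have hB := key d Q Q' hd
  have hsum := hasSum_le (fun z => ?_)
    ((((hw.summable.indicator P).hasSum.add (hw.summable.indicator P').hasSum).add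
      (hw.summable.indicator Q).hasSum).add (hw.summable.indicator Q').hasSum) hw
  · linarith
  rw [Set.disjoint_left] at h1 h2 h3 h4 h5 h6
  have := hw0 z
  simp only [Set.indicator_apply]
  split_ifs <;> first | linarith | (exfalso; simp_all)

/-- If `a` and `d` have a spectral gap, every pair `(u, w)` which an injective operator commuting
with left translations maps to a coboundary is itself a coboundary. -/
theorem exists_eq_coboundary {a d : Γ} {C : ℝ} (hC : 0 < C)
    (hgap : ∀ v : lp (fun _ : Γ => ℂ) 2,
      C * ‖v‖ ^ 2 ≤ ‖leftTranslation a v - v‖ ^ 2 + ‖leftTranslation d v - v‖ ^ 2)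
    {A : lp (fun _ : Γ => ℂ) 2 →ₗ[ℂ] lp (fun _ : Γ => ℂ) 2} (hA : Function.Injective A)
    (hcomm : ∀ γ v, A (leftTranslation γ v) = leftTranslation γ (A v))
    {u w h : lp (fun _ : Γ => ℂ) 2} (hu : A u = leftTranslation a h - h)
    (hw : A w = leftTranslation d h - h) :
    ∃ x, leftTranslation a x - x = u := by
  let D (γ : Γ) : lp (fun _ : Γ => ℂ) 2 →L[ℂ] lp (fun _ : Γ => ℂ) 2 :=
    (leftTranslation γ).toContinuousLinearMap - ContinuousLinearMap.id ℂ _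
  have hD : ∀ γ v, D γ v = leftTranslation γ v - v := fun _ _ => rfl
  have hDA : ∀ γ v, A (D γ v) = D γ (A v) := by
    intro γ v
    simp only [hD, map_sub, hcomm]
  have hinner : ∀ γ v w, inner ℂ (D γ⁻¹ v) w = inner ℂ v (D γ w) := by
    intro γ v w
    simp only [hD, inner_sub_left, inner_sub_right, inner_leftTranslation_inv]
  -- Since `D γ⁻¹` is adjoint to `D γ`, T is a Laplacian, and the gap makes it invertible. Solving
  -- the normal equation for x gives T(Ax) = Th, hence Ax = h.
  let T : lp (fun _ : Γ => ℂ) 2 →L[ℂ] lp (fun _ : Γ => ℂ) 2 := D a⁻¹ ∘L D a + D d⁻¹ ∘L D d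
  have hT : ∀ v, T v = D a⁻¹ (D a v) + D d⁻¹ (D d v) := fun _ => rfl
  have hTinner : ∀ v, inner ℂ (T v) v = ((‖D a v‖ ^ 2 + ‖D d v‖ ^ 2 : ℝ) : ℂ) := by
    intro v
    rw [hT, inner_add_left, hinner, hinner, inner_self_eq_norm_sq_to_K, inner_self_eq_norm_sq_to_K]
    push_cast
    rfl
  have hunit : IsUnit T := by
    refine ContinuousLinearMap.isUnit_of_forall_le_norm_inner_map T (c := ⟨C, hC.le⟩) hC fun v => ?_
    rw [hTinner, Complex.norm_real, Real.norm_of_nonneg (by positivity), mul_comm]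
    exact hgap v
  obtain ⟨hinj, hsurj⟩ := ContinuousLinearMap.isUnit_iff_bijective.1 hunit
  have hTA : ∀ v, A (T v) = T (A v) := by
    intro v
    simp only [hT, map_add, hDA]
  obtain ⟨x, hx⟩ := hsurj (D a⁻¹ u + D d⁻¹ w)
  refine ⟨x, ?_⟩
  have hAx : A x = h := by
    apply hinj
    rw [← hTA, hx, map_add, hDA, hDA, hu, hw, hT, hD a h, hD d h]
  apply hA
  rw [map_sub, hcomm, hAx, hu]

end LeftTranslation

/-! ### The group ring inside ℓ² -/

section GroupRing

variable {Γ : Type*}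

theorem rightRegular_apply [Group Γ] (h : MonoidAlgebra ℂ Γ) (v : lp (fun _ : Γ => ℂ) 2) (z : Γ) :
    rightRegular h v z = h.coeff.sum fun γ c => c * v (z * γ) := by
  rw [rightRegular, Finsupp.sum, LinearMap.sum_apply, lp.coeFn_sum, Finset.sum_apply]
  rfl

theorem rightRegular_groupRingAdjoint_apply [Group Γ] (f : MonoidAlgebra ℂ Γ) (v : lp (fun _ : Γ => ℂ) 2)
    (z : Γ) : rightRegular (groupRingAdjoint f) v z =
      f.coeff.sum fun γ c => starRingEnd ℂ c * v (z * γ⁻¹) := by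
  rw [rightRegular_apply, groupRingAdjoint, MonoidAlgebra.coeff_finsuppSum,
    Finsupp.sum_sum_index (by simp) (by intros; ring)]
  simp

theorem rightRegular_leftTranslation [Group Γ] (h : MonoidAlgebra ℂ Γ) (γ : Γ)
    (v : lp (fun _ : Γ => ℂ) 2) :
    rightRegular h (leftTranslation γ v) = leftTranslation γ (rightRegular h v) := by
  ext z
  simp only [rightRegular_apply, leftTranslation_apply, mul_assoc]

/-- An element of the integral group ring as a vector in `ℓ²(Γ, ℂ)`. -/
noncomputable def groupRingToL2 (k : MonoidAlgebra ℤ Γ) : lp (fun _ : Γ => ℂ) 2 :=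
  ⟨fun z => (k.coeff z : ℂ), (memℓp_zero (k.coeff.hasFiniteSupport.subset fun z hz => by
    simpa using hz)).of_exponent_ge (by norm_num)⟩

theorem groupRingToL2_apply (k : MonoidAlgebra ℤ Γ) (z : Γ) :
    groupRingToL2 k z = (k.coeff z : ℂ) := rfl

theorem groupRingToL2_single_mul [Group Γ] (γ : Γ) (k : MonoidAlgebra ℤ Γ) :
    groupRingToL2 (MonoidAlgebra.single γ 1 * k) = leftTranslation γ (groupRingToL2 k) := by
  ext z
  simp [groupRingToL2_apply, leftTranslation_apply]

theorem groupRingToL2_sub (k l : MonoidAlgebra ℤ Γ) :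
    groupRingToL2 (k - l) = groupRingToL2 k - groupRingToL2 l := by
  ext z
  simp [groupRingToL2_apply]

theorem groupRingToL2_injective : Function.Injective (groupRingToL2 (Γ := Γ)) := by
  intro k l h
  ext z
  have := congrArg (fun v : lp (fun _ : Γ => ℂ) 2 => v z) h
  simpa [groupRingToL2_apply] using this

/-- The inversion in f* turns right translations into right multiplication, so the analytic
hypothesis speaks about the left ideal generated by f. -/
theorem rightRegular_groupRingToL2 [Group Γ] (f k : MonoidAlgebra ℤ Γ) :
    rightRegular (groupRingAdjoint (MonoidAlgebra.mapRingHom Γ (Int.castRingHom ℂ) f))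
      (groupRingToL2 k) = groupRingToL2 (k * f) := by
  ext z
  rw [rightRegular_groupRingAdjoint_apply, groupRingToL2_apply, MonoidAlgebra.coeff_mul_apply_right,
    Finsupp.sum_of_support_subset (s := f.coeff.support) _ (fun z hz => ?_) _ (by simp)]
  · simp only [Finsupp.sum, Int.cast_sum, Int.cast_mul]
    refine Finset.sum_congr rfl fun γ _ => ?_
    simp [groupRingToL2_apply, mul_comm]
  · simpa using hz

theorem rightRegular_injective [Group Γ] (hΓ : SatisfiesAnalyticZeroDivisorConjecture Γ)
    {f : MonoidAlgebra ℤ Γ} (hf : f ≠ 0) : Function.Injective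
      (rightRegular (groupRingAdjoint (MonoidAlgebra.mapRingHom Γ (Int.castRingHom ℂ) f))) := by
  refine LinearMap.ker_eq_bot.1 (hΓ _ fun h => hf ?_)
  ext z
  have := congrArg (fun k : MonoidAlgebra ℂ Γ => k.coeff z) h
  simpa using this

end GroupRing

/-! ### Cocycles on a subgroup of finite index -/

section Cocycle

variable {Γ : Type*} [Group Γ]

/-- Choose representatives t(z) of the right cosets Hz and put π(z) = z t(z)⁻¹. This carries
constructions on H over to Γ coset by coset. -/
theorem exists_equivariant_map_subgroup (H : Subgroup Γ) :
    ∃ π : Γ → H, ∀ (k : H) (z : Γ), π (k * z) = k * π z := by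
  let t : Γ → Γ := fun z => (Quotient.mk (QuotientGroup.rightRel H) z).out
  have ht : ∀ z, z * (t z)⁻¹ ∈ H := fun z =>
    QuotientGroup.rightRel_apply.1 (Quotient.exact (Quotient.out_eq _))
  refine ⟨fun z => ⟨z * (t z)⁻¹, ht z⟩, fun k z => Subtype.ext ?_⟩
  have : t (k * z) = t z := by
    refine congrArg Quotient.out (Quotient.sound ?_)
    rw [← Quotient.eq_iff_equiv, Quotient.eq, QuotientGroup.rightRel_apply]
    simp
  simp [this, mul_assoc]

/-- Inverting the cover gives H ⊆ F⁻¹⟨γ⟩, so the products of representatives of Γ/H with F⁻¹ meet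
every left coset of ⟨γ⟩. -/
theorem finiteIndex_zpowers_of_cover {H : Subgroup Γ} [H.FiniteIndex] {γ : Γ} {F : Set Γ}
    (hF : F.Finite) (hcov : ∀ g ∈ H, ∃ j : ℤ, ∃ w ∈ F, g = γ ^ j * w) :
    (Subgroup.zpowers γ).FiniteIndex := by
  have := hF.to_subtype
  have hsurj : Function.Surjective fun x : (Γ ⧸ H) × F =>
      (QuotientGroup.mk (x.1.out * (x.2 : Γ)⁻¹) : Γ ⧸ Subgroup.zpowers γ) := by
    intro x
    induction x using QuotientGroup.induction_on with | H g => ?_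
    have hg : (QuotientGroup.mk g : Γ ⧸ H).out⁻¹ * g ∈ H :=
      QuotientGroup.eq.1 (QuotientGroup.out_eq' _)
    obtain ⟨j, w, hw, h⟩ := hcov _ (inv_mem hg)
    refine ⟨(QuotientGroup.mk g, ⟨w, hw⟩), QuotientGroup.eq.2 ⟨-j, ?_⟩⟩
    simp only [mul_inv_rev, inv_inv] at h ⊢
    have : w = γ ^ (-j) * (g⁻¹ * (QuotientGroup.mk g : Γ ⧸ H).out) := by rw [h]; group
    rw [this]; group
  have := Finite.of_surjective _ hsurj
  exact Subgroup.finiteIndex_of_finite_quotient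

theorem eq_zero_of_single_mul_eq {γ : Γ} (hγ : Function.Injective fun n : ℤ => γ ^ n)
    {k : MonoidAlgebra ℤ Γ} (hk : MonoidAlgebra.single γ 1 * k = k) : k = 0 := by
  have hinv : ∀ z, k.coeff (γ * z) = k.coeff z := by
    intro z
    conv_lhs => rw [← hk]
    simp
  ext z
  by_contra hz
  have : (k.coeff.support : Set Γ).Infinite := by
    refine Set.infinite_of_injective_forall_mem (f := fun n : ℤ => γ ^ n * z)
      (fun m n h => hγ (by simpa using h)) fun n => ?_
    have := apply_zpow_mul_eq (b := k.coeff) (γ := γ) (w := z) (fun _ => hinv _) n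
    simpa [this] using hz
  exact this k.coeff.support.finite_toSet

open Filter in
theorem tendsto_lp_cofinite {ι : Type*} (v : lp (fun _ : ι => ℂ) 2) :
    Tendsto (fun z => v z) cofinite (nhds 0) := by
  have h := (hasSum_norm_sq v).summable.tendsto_cofinite_zero.sqrt
  rw [tendsto_zero_iff_norm_tendsto_zero]
  simpa using h

/-- A cocycle with values in the group ring is the coboundary of an integer-valued function. -/
theorem exists_primitive {H : Subgroup Γ} {c : Γ → MonoidAlgebra ℤ Γ}
    (hc : ∀ γ ∈ H, ∀ δ ∈ H, c (γ * δ) = MonoidAlgebra.single γ 1 * c δ + c γ) :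
    ∃ b : Γ → ℤ, ∀ γ ∈ H, ∀ z, b (γ⁻¹ * z) = (c γ).coeff z + b z := by
  obtain ⟨π, hπ⟩ := exists_equivariant_map_subgroup H
  -- This is the solution that vanishes on the chosen coset representatives.
  refine ⟨fun z => (c (π z)⁻¹).coeff ((π z : Γ)⁻¹ * z), fun γ hγ z => ?_⟩
  have h1 : π (γ⁻¹ * z) = ⟨γ, hγ⟩⁻¹ * π z := hπ ⟨γ, hγ⟩⁻¹ z
  have h2 : ((π (γ⁻¹ * z) : Γ)⁻¹) = (π z : Γ)⁻¹ * γ := by rw [h1]; simp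
  simp only [h2]
  rw [hc _ (inv_mem (π z).2) _ hγ]
  simp [mul_assoc]

open Filter in
/-- If `b` is almost invariant under `H` and has different limits at the two ends of some
`γ`-orbit, then two translations in `H`, one of them by a power of `γ`, have a spectral gap. -/
theorem exists_spectral_gap {H : Subgroup Γ} {b : Γ → ℤ}
    (hb : ∀ k ∈ H, ∀ᶠ z in cofinite, b (k * z) = b z) {γ g : Γ} (hγH : γ ∈ H) (hgH : g ∈ H)
    (hγ : Function.Injective fun n : ℤ => γ ^ n) (hg : ¬ Commensurates γ g)
    {p q : ℤ} (hpq : p ≠ q) {y : Γ} (hp : ∀ᶠ n : ℤ in atTop, b (γ ^ n * y) = p)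
    (hq : ∀ᶠ n : ℤ in atBot, b (γ ^ n * y) = q) :
    ∃ m : ℤ, m ≠ 0 ∧ ∃ d ∈ H, ∀ v : lp (fun _ : Γ => ℂ) 2, (1 / 8) * ‖v‖ ^ 2 ≤
      ‖leftTranslation (γ ^ m) v - v‖ ^ 2 + ‖leftTranslation d v - v‖ ^ 2 := by
  -- The ping-pong sets need a finite generating set, so they are built in ⟨γ, g⟩ and pulled back to
  -- Γ along an equivariant map, inverted to turn left into right multiplication.
  let G := Subgroup.closure {γ, g}
  have hGH : G ≤ H := by
    rw [Subgroup.closure_le]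
    rintro x (rfl | rfl) <;> assumption
  let γ' : G := ⟨γ, Subgroup.subset_closure (by simp)⟩
  let g' : G := ⟨g, Subgroup.subset_closure (by simp)⟩
  have hS : Subgroup.closure {γ', g'} = ⊤ := by
    rw [← Subgroup.closure_closure_coe_preimage (k := {γ, g})]
    congr 1
    ext x
    simp [γ', g', Subtype.ext_iff]
  have hinj : Function.Injective fun x : G => (x : Γ) * y :=
    (mul_left_injective y).comp Subtype.val_injective
  obtain ⟨m, n, hm, P, P', Q, Q', h1, h2, h3, h4, h5, h6, hP, hQ⟩ :=
    exists_paradoxical_sets (γ := γ') (g := g') (b := fun x : G => b (x * y)) hS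
      (fun i j h => hγ (by simpa [γ', Subtype.ext_iff] using h))
      (fun k => by
        filter_upwards [hinj.tendsto_cofinite.eventually (hb k (hGH k.2))] with z hz
        simpa [mul_assoc] using hz)
      (fun ⟨r, s, hr, hs, h⟩ => hg ⟨r, s, hr, hs, by simpa [γ', g', Subtype.ext_iff] using h⟩)
      hpq (by simpa [γ'] using hp) (by simpa [γ'] using hq)
  obtain ⟨π, hπ⟩ := exists_equivariant_map_subgroup G
  refine ⟨m, hm, g⁻¹ * γ ^ n * g,
    mul_mem (mul_mem (inv_mem hgH) (zpow_mem hγH n)) hgH, fun v => ?_⟩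
  let f : Γ → G := fun x => (π x)⁻¹
  have := norm_sq_le_of_paradoxical (a := γ ^ m) (d := g⁻¹ * γ ^ n * g) (h1.preimage f)
    (h2.preimage f) (h3.preimage f) (h4.preimage f) (h5.preimage f) (h6.preimage f)
    (fun z hz => ?_) (fun z hz => ?_) v
  · linarith
  · have h := hP _ hz
    have he : f ((γ ^ m)⁻¹ * z) = f z * γ' ^ m := by
      simpa [f] using congrArg (·⁻¹) (hπ (γ' ^ m)⁻¹ z)
    simpa only [Set.mem_preimage, he] using h
  · have h := hQ _ hz
    have he : f ((g⁻¹ * γ ^ n * g)⁻¹ * z) = f z * (g'⁻¹ * γ' ^ n * g') := by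
      have := congrArg (·⁻¹) (hπ (g'⁻¹ * γ' ^ n * g')⁻¹ z)
      simpa only [f, mul_inv_rev (_ : G) (π z), inv_inv, Subgroup.coe_inv, Subgroup.coe_mul,
        Subgroup.coe_zpow] using this
    simpa only [Set.mem_preimage, he] using h

-- The core dichotomy: either b has equal limits at the two ends of every γ-orbit, and its finitely
-- supported part is the quotient k, or unequal limits contradict the spectral gap.
open Filter in
theorem exists_mul_eq_of_finiteIndex (htf : IsTorsionFreeGroup Γ) (hvc : ¬ IsVirtuallyCyclic Γ)
    (hΓ : SatisfiesAnalyticZeroDivisorConjecture Γ) {f : MonoidAlgebra ℤ Γ} (hf : f ≠ 0)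
    (H : Subgroup Γ) [hH : H.FiniteIndex] {h : MonoidAlgebra ℤ Γ}
    (hh : ∀ γ ∈ H, ∃ c, c * f = MonoidAlgebra.single γ 1 * h - h) : ∃ k, k * f = h := by
  have hA := rightRegular_injective hΓ hf
  have hinj : ∀ {k l : MonoidAlgebra ℤ Γ}, k * f = l * f → k = l := fun {k l} hkl => by
    apply groupRingToL2_injective
    apply hA
    rw [rightRegular_groupRingToL2, rightRegular_groupRingToL2, hkl]
  choose! c hc using hh
  have hcoc : ∀ γ ∈ H, ∀ δ ∈ H, c (γ * δ) = MonoidAlgebra.single γ 1 * c δ + c γ := by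
    intro γ hγ δ hδ
    apply hinj
    rw [add_mul, mul_assoc, hc _ (mul_mem hγ hδ), hc _ hγ, hc _ hδ, mul_sub, ← mul_assoc,
      MonoidAlgebra.single_mul_single, one_mul]
    abel
  obtain ⟨b, hb⟩ := exists_primitive hcoc
  have hbai : ∀ k ∈ H, ∀ᶠ z in cofinite, b (k * z) = b z := by
    intro k hk
    refine (c k⁻¹).coeff.hasFiniteSupport.subset fun z hz => ?_
    have := hb _ (inv_mem hk) z
    rw [inv_inv] at this
    simp only [Set.mem_compl_iff, Set.mem_ofPred_eq, this, add_eq_right] at hz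
    exact hz
  obtain ⟨γ, hγH, hγ1⟩ : ∃ γ ∈ H, γ ≠ 1 := by
    refine H.bot_or_exists_ne_one.resolve_left fun hbot => ?_
    subst hbot
    exact hvc ⟨⊥, inferInstance, hH⟩
  have hγ : Function.Injective fun n : ℤ => γ ^ n :=
    injective_zpow_iff_not_isOfFinOrder.2 fun h => hγ1 (htf γ h)
  choose p hp using exists_limit_atTop hγ (hbai γ hγH)
  choose q hq using exists_limit_atBot hγ (hbai γ hγH)
  by_cases hpq : p = q
  · subst hpq
    obtain ⟨hinv, hfin⟩ := exists_finite_support_of_limits_eq (hbai γ hγH) hp hq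
    let k : MonoidAlgebra ℤ Γ := .ofCoeff (Finsupp.ofSupportFinite (fun z => b z - p z)
      (hfin.subset fun z hz => by simpa [sub_eq_zero] using hz))
    have hk : ∀ z, k.coeff z = b z - p z := fun _ => rfl
    have hcob : MonoidAlgebra.single γ 1 * k - k = c γ := by
      ext z
      have h1 := hb γ hγH z
      have h2 := hinv (-1) z
      rw [zpow_neg_one] at h2
      simp only [MonoidAlgebra.coeff_sub, Finsupp.sub_apply, MonoidAlgebra.coeff_single_mul_apply,
        hk, h1, h2]
      ring
    refine ⟨k, (sub_eq_zero.1 (eq_zero_of_single_mul_eq hγ ?_)).symm⟩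
    rw [mul_sub, ← mul_assoc, sub_eq_sub_iff_sub_eq_sub, ← sub_mul, hcob, hc γ hγH]
  · exfalso
    obtain ⟨y, hy⟩ := Function.ne_iff.1 hpq
    obtain ⟨g, hgH, hg⟩ : ∃ g ∈ H, ¬ Commensurates γ g := by
      by_contra! hcon
      obtain ⟨F, hF, hcov⟩ := exists_finite_cover_of_commensurates hγ hγH hbai hcon hy (hp y) (hq y)
      exact hvc ⟨Subgroup.zpowers γ, inferInstance, finiteIndex_zpowers_of_cover hF hcov⟩
    obtain ⟨m, hm, d, hd, hgap⟩ := exists_spectral_gap hbai hγH hgH hγ hg hy (hp y) (hq y)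
    have hr : ∀ δ ∈ H, rightRegular (groupRingAdjoint
        (MonoidAlgebra.mapRingHom Γ (Int.castRingHom ℂ) f)) (groupRingToL2 (c δ)) =
        leftTranslation δ (groupRingToL2 h) - groupRingToL2 h := fun δ hδ => by
      rw [rightRegular_groupRingToL2, hc δ hδ, groupRingToL2_sub, groupRingToL2_single_mul]
    obtain ⟨x, hx⟩ := exists_eq_coboundary (by norm_num) hgap hA
      (rightRegular_leftTranslation _) (hr _ (zpow_mem hγH m)) (hr _ hd)
    have hconst : ∀ j : ℤ, x ((γ ^ m) ^ j * y) - b ((γ ^ m) ^ j * y) = x y - b y := by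
      refine apply_zpow_mul_eq (b := fun z => x z - (b z : ℂ)) fun j => ?_
      set w := (γ ^ m) ^ j * y
      have h1 := congrArg (fun v : lp (fun _ : Γ => ℂ) 2 => v (γ ^ m * w)) hx
      have h2 := hb _ (zpow_mem hγH m) (γ ^ m * w)
      simp only [lp.coeFn_sub, Pi.sub_apply, leftTranslation_apply, groupRingToL2_apply,
        inv_mul_cancel_left] at h1 h2
      rw [h2, Int.cast_add, ← h1]
      ring
    have lim : ∀ {l l' : Filter ℤ} [l.NeBot] {v : ℤ}, l' ≤ cofinite →
        Tendsto (fun j : ℤ => m * j) l l' → (∀ᶠ n in l', b (γ ^ n * y) = v) →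
        x y - b y = - (v : ℂ) := by
      intro l l' _ v hl' ht hv
      have h1 : Tendsto (fun j : ℤ => x ((γ ^ m) ^ j * y) - b ((γ ^ m) ^ j * y)) l
          (nhds (0 - (v : ℂ))) := by
        refine Tendsto.sub ?_ ?_
        · have := (tendsto_lp_cofinite x).comp ((tendsto_zpow_mul_cofinite hγ 1 y).comp
            (ht.mono_right hl'))
          simpa [Function.comp_def, zpow_mul] using this
        · refine tendsto_const_nhds.congr' ?_
          filter_upwards [ht.eventually hv] with j hj
          rw [← zpow_mul, hj]
      simp only [hconst, zero_sub] at h1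
      exact tendsto_nhds_unique tendsto_const_nhds h1
    obtain ⟨⟨l, _, t⟩, l', _, t'⟩ := exists_tendsto_const_mul_int hm
    have := (lim int_atTop_le_cofinite t (hp y)).symm.trans (lim int_atBot_le_cofinite t' (hq y))
    exact hy (by simpa using this)

end Cocycle

/-! ### Pontryagin duality between ℤΓ/ℤΓf and X_f -/

section Duality

variable {Γ : Type*}

/-- The pairing between the integral group ring and `𝕋^Γ`. -/
noncomputable def groupRingPairing :
    MonoidAlgebra ℤ Γ →+ (Γ → UnitAddCircle) →+ UnitAddCircle where
  toFun h := h.coeff.sum fun γ n => n • Pi.evalAddMonoidHom _ γ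
  map_zero' := Finsupp.sum_zero_index
  map_add' h k := by
    rw [MonoidAlgebra.coeff_add]
    exact Finsupp.sum_add_index' (by simp) fun γ m n => add_zsmul _ m n

theorem groupRingPairing_apply (h : MonoidAlgebra ℤ Γ) (x : Γ → UnitAddCircle) :
    groupRingPairing h x = h.coeff.sum fun γ n => n • x γ := by
  simp [groupRingPairing, Finsupp.sum]

theorem groupRingPairing_single (γ : Γ) (n : ℤ) (x : Γ → UnitAddCircle) :
    groupRingPairing (MonoidAlgebra.single γ n) x = n • x γ := by
  simp [groupRingPairing_apply]

variable [Group Γ]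

theorem groupRingPairing_single_mul (γ : Γ) (n : ℤ) (h : MonoidAlgebra ℤ Γ)
    (x : Γ → UnitAddCircle) : groupRingPairing (MonoidAlgebra.single γ n * h) x =
      n • h.coeff.sum fun δ m => m • x (γ * δ) := by
  rw [← groupRingPairing_apply h fun δ => x (γ * δ)]
  have : (AddMonoidHom.eval x).comp
        (groupRingPairing.comp (AddMonoidHom.mulLeft (MonoidAlgebra.single γ n))) =
      n • (AddMonoidHom.eval fun δ => x (γ * δ)).comp groupRingPairing := by
    refine MonoidAlgebra.addMonoidHom_ext fun δ m => ?_
    change groupRingPairing (MonoidAlgebra.single γ n * MonoidAlgebra.single δ m) x =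
      n • groupRingPairing (MonoidAlgebra.single δ m) _
    rw [MonoidAlgebra.single_mul_single, groupRingPairing_single, groupRingPairing_single, mul_smul]
  exact DFunLike.congr_fun this h

theorem groupRingPairing_mul_eq_zero (f k : MonoidAlgebra ℤ Γ) {x : Γ → UnitAddCircle}
    (hx : x ∈ principalGroup f) : groupRingPairing (k * f) x = 0 := by
  have hx' : ∀ γ, (f.coeff.sum fun δ m => m • x (γ * δ)) = 0 := fun γ => by
    rw [← rightShiftRing_apply]
    exact congrFun hx γ
  have : (AddMonoidHom.eval x).comp (groupRingPairing.comp (AddMonoidHom.mulRight f)) = 0 := by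
    refine MonoidAlgebra.addMonoidHom_ext fun γ n => ?_
    change groupRingPairing (MonoidAlgebra.single γ n * f) x = 0
    rw [groupRingPairing_single_mul, hx', smul_zero]
  exact DFunLike.congr_fun this k

/-- Characters into ℚ/ℤ already separate points, and ℚ/ℤ embeds in ℝ/ℤ. -/
theorem exists_addMonoidHom_unitAddCircle_ne_zero {A : Type*} [AddCommGroup A] {a : A}
    (ha : a ≠ 0) : ∃ c : A →+ UnitAddCircle, c a ≠ 0 := by
  obtain ⟨c, hc⟩ := CharacterModule.exists_character_apply_ne_zero_of_ne_zero ha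
  let ι : AddCircle (1 : ℚ) →+ UnitAddCircle :=
    QuotientAddGroup.map _ _ (Rat.castHom ℝ).toAddMonoidHom (by
      rintro _ ⟨n, rfl⟩
      exact ⟨n, by simp⟩)
  refine ⟨ι.comp c, fun h => hc ?_⟩
  replace h : ι (c a) = 0 := h
  generalize c a = t at h
  induction t using QuotientAddGroup.induction_on with | H q => ?_
  have h' : ((q : ℝ) : UnitAddCircle) = 0 := h
  obtain ⟨n, hn⟩ := (AddCircle.coe_eq_zero_iff _).1 h'
  refine (AddCircle.coe_eq_zero_iff _).2 ⟨n, ?_⟩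
  rw [zsmul_one] at hn ⊢
  exact_mod_cast hn

/-- An element of the group ring that annihilates `X_f` lies in the left ideal generated by `f`. -/
theorem exists_mul_eq_of_groupRingPairing_eq_zero {f h : MonoidAlgebra ℤ Γ}
    (hh : ∀ x ∈ principalGroup f, groupRingPairing h x = 0) : ∃ k, k * f = h := by
  rw [← Ideal.mem_span_singleton']
  by_contra hcon
  obtain ⟨c, hc⟩ := exists_addMonoidHom_unitAddCircle_ne_zero
    (a := (Ideal.span {f}).mkQ h) (by simpa using hcon)
  let c' : MonoidAlgebra ℤ Γ →+ UnitAddCircle := c.comp (Ideal.span {f}).mkQ.toAddMonoidHom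
  -- A homomorphism ℤΓ → 𝕋 is pairing with its values on group elements; as it kills ℤΓf, this point
  -- lies in X_f.
  let x : Γ → UnitAddCircle := fun γ => c' (MonoidAlgebra.single γ 1)
  have hx : (AddMonoidHom.eval x).comp groupRingPairing = c' := by
    refine MonoidAlgebra.addMonoidHom_ext fun γ n => ?_
    change groupRingPairing (MonoidAlgebra.single γ n) x = _
    rw [groupRingPairing_single, ← map_zsmul, MonoidAlgebra.smul_single, smul_eq_mul, mul_one]
  have hx' : ∀ k, groupRingPairing k x = c' k := fun k => DFunLike.congr_fun hx k
  refine hc ((hx' h).symm.trans (hh x ?_))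
  rw [principalGroup, AddMonoidHom.mem_ker]
  funext γ
  have h0 : (Ideal.span {f}).mkQ (MonoidAlgebra.single γ 1 * f) = 0 := by
    simpa using Ideal.mul_mem_left _ _ (Ideal.mem_span_singleton_self f)
  have := hx' (MonoidAlgebra.single γ 1 * f)
  rw [groupRingPairing_single_mul, one_smul, ← rightShiftRing_apply] at this
  rw [this]
  exact (congrArg c h0).trans (map_zero c)

end Duality

/-! ### Fourier analysis on X_f and ergodicity -/

section Ergodicity

variable {Γ : Type*} [Group Γ] {f : MonoidAlgebra ℤ Γ}

/-- The character of `X_f` defined by an element of the integral group ring. -/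
noncomputable def principalCharacter (f h : MonoidAlgebra ℤ Γ) :
    BoundedContinuousFunction (principalGroup f) ℂ :=
  .mkOfCompact ⟨fun x => (AddCircle.toCircle (groupRingPairing h x.1) : ℂ), by
    refine Continuous.comp (by fun_prop) (AddCircle.continuous_toCircle.comp ?_)
    simp only [groupRingPairing_apply, Finsupp.sum]
    exact continuous_finsetSum _ fun γ _ =>
      ((continuous_apply γ).comp continuous_subtype_val).zsmul _⟩

theorem principalCharacter_apply (h : MonoidAlgebra ℤ Γ) (x : principalGroup f) :
    principalCharacter f h x = AddCircle.toCircle (groupRingPairing h x.1) := rfl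

theorem principalCharacter_zero : principalCharacter f 0 = 1 := by
  ext x
  simp [principalCharacter_apply]

theorem principalCharacter_add (h k : MonoidAlgebra ℤ Γ) :
    principalCharacter f (h + k) = principalCharacter f h * principalCharacter f k := by
  ext x
  simp [principalCharacter_apply, AddCircle.toCircle_add]

theorem principalCharacter_neg (h : MonoidAlgebra ℤ Γ) :
    principalCharacter f (-h) = star (principalCharacter f h) := by
  ext x
  rw [BoundedContinuousFunction.star_apply, principalCharacter_apply, principalCharacter_apply,
    map_neg, AddMonoidHom.neg_apply, AddCircle.toCircle_neg, Circle.coe_inv_eq_conj]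
  rfl

theorem principalCharacter_apply_add (h : MonoidAlgebra ℤ Γ) (x y : principalGroup f) :
    principalCharacter f h (x + y) = principalCharacter f h x * principalCharacter f h y := by
  simp [principalCharacter_apply, AddCircle.toCircle_add]

theorem principalCharacter_apply_smul (h : MonoidAlgebra ℤ Γ) (γ : Γ) (x : principalGroup f) :
    principalCharacter f h (γ • x) =
      principalCharacter f (MonoidAlgebra.single γ⁻¹ 1 * h) x := by
  rw [principalCharacter_apply, principalCharacter_apply, groupRingPairing_single_mul, one_smul,
    groupRingPairing_apply]
  rfl

theorem principalCharacter_eq_one_iff (h : MonoidAlgebra ℤ Γ) :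
    principalCharacter f h = 1 ↔ ∃ k, k * f = h := by
  constructor
  · intro h1
    refine exists_mul_eq_of_groupRingPairing_eq_zero fun x hx => ?_
    have := DFunLike.congr_fun h1 (⟨x, hx⟩ : principalGroup f)
    rw [principalCharacter_apply] at this
    apply AddCircle.injective_toCircle one_ne_zero
    rw [AddCircle.toCircle_zero]
    exact Circle.ext this
  · rintro ⟨k, rfl⟩
    ext x
    simp [principalCharacter_apply, groupRingPairing_mul_eq_zero f k x.2]

theorem principalCharacter_eq_iff (h k : MonoidAlgebra ℤ Γ) :
    principalCharacter f h = principalCharacter f k ↔ principalCharacter f (h - k) = 1 := by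
  have hk : principalCharacter f (-k) * principalCharacter f k = 1 := by
    rw [← principalCharacter_add, neg_add_cancel, principalCharacter_zero]
  constructor
  · intro e
    rw [sub_eq_add_neg, principalCharacter_add, e, mul_comm, hk]
  · intro e
    rw [← sub_add_cancel h k, principalCharacter_add, e, one_mul]

/-- The star algebra generated by the characters of `X_f`. -/
noncomputable def principalCharacterAlgebra (f : MonoidAlgebra ℤ Γ) :
    StarSubalgebra ℂ (BoundedContinuousFunction (principalGroup f) ℂ) :=
  StarAlgebra.adjoin ℂ (Set.range (principalCharacter f))

theorem mem_span_of_mem_principalCharacterAlgebra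
    {g : BoundedContinuousFunction (principalGroup f) ℂ} (hg : g ∈ principalCharacterAlgebra f) :
    g ∈ Submodule.span ℂ (Set.range (principalCharacter f)) := by
  have hstar : star (Set.range (principalCharacter f)) ⊆ Set.range (principalCharacter f) := by
    rintro φ ⟨h, hh⟩
    exact ⟨-h, by rw [principalCharacter_neg, hh, star_star]⟩
  rw [principalCharacterAlgebra, ← StarSubalgebra.mem_toSubalgebra,
    StarAlgebra.adjoin_toSubalgebra, Set.union_eq_self_of_subset_right hstar,
    ← Subalgebra.mem_toSubmodule, Algebra.adjoin_eq_span_of_subset] at hg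
  · exact hg
  · intro φ hφ
    refine Submodule.subset_span ?_
    induction hφ using Submonoid.closure_induction with
    | mem x hx => exact hx
    | one => exact ⟨0, principalCharacter_zero⟩
    | mul x y _ _ hx hy =>
      obtain ⟨h, rfl⟩ := hx
      obtain ⟨k, rfl⟩ := hy
      exact ⟨h + k, principalCharacter_add h k⟩

theorem separatesPoints_principalCharacterAlgebra (f : MonoidAlgebra ℤ Γ) :
    ((principalCharacterAlgebra f).map
      (BoundedContinuousFunction.toContinuousMapStarₐ ℂ)).SeparatesPoints := by
  intro x y hxy
  obtain ⟨γ, hγ⟩ : ∃ γ, x.1 γ ≠ y.1 γ := Function.ne_iff.1 fun h => hxy (Subtype.ext h)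
  refine ⟨_, ⟨_, ⟨principalCharacter f (MonoidAlgebra.single γ 1),
    StarAlgebra.subset_adjoin _ _ ⟨_, rfl⟩, rfl⟩, rfl⟩, fun h => hγ ?_⟩
  apply AddCircle.injective_toCircle one_ne_zero
  apply Circle.ext
  change principalCharacter f (MonoidAlgebra.single γ 1) x =
    principalCharacter f (MonoidAlgebra.single γ 1) y at h
  simpa only [principalCharacter_apply, groupRingPairing_single, one_smul] using h

variable [Countable Γ]

instance principalHaar_isAddHaarMeasure (f : MonoidAlgebra ℤ Γ) :
    (principalHaar f).IsAddHaarMeasure := by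
  unfold principalHaar
  infer_instance

theorem measurePreserving_principalAction (f : MonoidAlgebra ℤ Γ) (γ : Γ) :
    MeasurePreserving (γ • · : principalGroup f → principalGroup f)
      (principalHaar f) (principalHaar f) :=
  AddMonoidHom.measurePreserving (f := DistribSMul.toAddMonoidHom (principalGroup f) γ)
    (continuous_const_smul γ) (MulAction.surjective γ) rfl

theorem integral_principalCharacter_eq_zero {h : MonoidAlgebra ℤ Γ}
    (hh : principalCharacter f h ≠ 1) : ∫ x, principalCharacter f h x ∂principalHaar f = 0 := by
  obtain ⟨y, hy⟩ := DFunLike.ne_iff.1 hh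
  have := integral_add_left_eq_self (μ := principalHaar f) (fun x => principalCharacter f h x) y
  simp only [principalCharacter_apply_add, integral_const_mul] at this
  exact (mul_left_eq_self₀.1 this).resolve_left hy

theorem orthonormal_principalCharacter {ι : Type*} {h : ι → MonoidAlgebra ℤ Γ}
    (hinj : Function.Injective fun i => principalCharacter f (h i)) :
    Orthonormal ℂ fun i =>
      BoundedContinuousFunction.toLp 2 (principalHaar f) ℂ (principalCharacter f (h i)) := by
  classical
  rw [orthonormal_iff_ite]
  intro i j
  have : ∀ x, principalCharacter f (h j) x * starRingEnd ℂ (principalCharacter f (h i) x) =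
      principalCharacter f (h j - h i) x := by
    intro x
    rw [sub_eq_add_neg, principalCharacter_add, principalCharacter_neg]
    rfl
  rw [BoundedContinuousFunction.inner_toLp]
  simp only [this]
  split_ifs with hij
  · subst hij
    simp [principalCharacter_zero]
  · refine integral_principalCharacter_eq_zero fun e => hij (hinj ?_).symm
    exact (principalCharacter_eq_iff _ _).2 e

-- The Fourier coefficients of an invariant set are constant along the orbit of a character. An
-- infinite orbit is an infinite orthonormal family, so Bessel's inequality makes that constant
-- zero.
open Filter in
theorem setIntegral_principalCharacter_eq_zero {s : Set (principalGroup f)} (hs : MeasurableSet s)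
    (hinv : ∀ γ : Γ, (γ • ·) ⁻¹' s =ᵐ[principalHaar f] s) {h : MonoidAlgebra ℤ Γ} {ι : Type*}
    [Infinite ι] {g : ι → Γ} (hinj : Function.Injective fun i =>
      principalCharacter f (MonoidAlgebra.single (g i) 1 * h)) :
    ∫ x in s, principalCharacter f h x ∂principalHaar f = 0 := by
  have hsum := (orthonormal_principalCharacter hinj).inner_products_summable
    (indicatorConstLp 2 hs (measure_ne_top (principalHaar f) s) (1 : ℂ))
  have hconst : ∀ i, ∫ x in s, principalCharacter f (MonoidAlgebra.single (g i) 1 * h) x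
      ∂principalHaar f = ∫ x in s, principalCharacter f h x ∂principalHaar f := by
    intro i
    have := (measurePreserving_principalAction f (g i)⁻¹).setIntegral_preimage_emb
      (measurableEmbedding_const_smul _) (principalCharacter f h) s
    rw [setIntegral_congr_set (hinv _)] at this
    simpa only [principalCharacter_apply_smul, inv_inv] using this
  have hinner : ∀ i, ‖inner ℂ (BoundedContinuousFunction.toLp 2 (principalHaar f) ℂ
      (principalCharacter f (MonoidAlgebra.single (g i) 1 * h)))
      (indicatorConstLp 2 hs (measure_ne_top (principalHaar f) s) (1 : ℂ))‖ ^ 2 =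
      ‖∫ x in s, principalCharacter f h x ∂principalHaar f‖ ^ 2 := by
    intro i
    rw [norm_inner_symm, L2.inner_indicatorConstLp_one, ← hconst i]
    congr 2
    exact setIntegral_congr_ae hs ((BoundedContinuousFunction.coeFn_toLp _ _ _ _).mono
      fun x hx _ => hx)
  simp only [hinner, summable_const_iff] at hsum
  simpa using hsum

/-- If every character of `X_f` with a stabilizer of finite index is trivial, the action of `Γ`
on `X_f` is ergodic. -/
theorem ergodicSMul_of_forall_finiteIndex (f : MonoidAlgebra ℤ Γ)
    (H : ∀ (h : MonoidAlgebra ℤ Γ) (K : Subgroup Γ), K.FiniteIndex →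
      (∀ γ ∈ K, ∃ c, c * f = MonoidAlgebra.single γ 1 * h - h) → ∃ k, k * f = h) :
    ErgodicSMul Γ (principalGroup f) (principalHaar f) where
  measure_preimage_smul γ s hs :=
    (measurePreserving_principalAction f γ).measure_preimage hs.nullMeasurableSet
  aeconst_of_forall_preimage_smul_ae_eq {s} hs hinv := by
    set μ := principalHaar f
    have hzero : ∀ h, principalCharacter f h ≠ 1 → ∫ x in s, principalCharacter f h x ∂μ = 0 := by
      intro h hh
      let K : Subgroup Γ :=
        { carrier := {γ | ∀ x, principalCharacter f h (γ • x) = principalCharacter f h x}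
          mul_mem' := fun {γ δ} hγ hδ x => by rw [mul_smul, hγ, hδ]
          one_mem' := fun x => by rw [one_smul]
          inv_mem' := fun {γ} hγ x => by rw [← hγ, smul_inv_smul] }
      have hK : ∀ γ, γ ∈ K ↔ ∀ x, principalCharacter f h (γ • x) = principalCharacter f h x :=
        fun _ => Iff.rfl
      by_cases hfin : K.FiniteIndex
      · refine absurd ((principalCharacter_eq_one_iff h).2 (H h K hfin fun γ hγ => ?_)) hh
        rw [← principalCharacter_eq_one_iff, ← principalCharacter_eq_iff]
        ext x
        have := (hK _).1 (inv_mem hγ) x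
        rwa [principalCharacter_apply_smul, inv_inv] at this
      · have : Infinite (Γ ⧸ K) := by
          rw [← not_finite_iff_infinite]
          exact fun h => hfin (Subgroup.finiteIndex_of_finite_quotient)
        refine setIntegral_principalCharacter_eq_zero (ι := Γ ⧸ K) (g := Quotient.out) hs hinv ?_
        intro i j hij
        rw [← Quotient.out_eq i, ← Quotient.out_eq j]
        refine QuotientGroup.eq.2 ((hK _).2 fun x => ?_)
        have := DFunLike.congr_fun hij (j.out • x)
        simp only at this
        rw [← inv_inv i.out, ← inv_inv j.out, ← principalCharacter_apply_smul,
          ← principalCharacter_apply_smul] at this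
        simpa [mul_smul] using this
    -- Both measures have the same integral against every character, and the characters span a
    -- point-separating star algebra. Evaluating at the complement of s then gives 0 = μ(s) μ(sᶜ).
    have hμ : μ.restrict s = μ s • μ := by
      have : IsFiniteMeasure (μ s • μ) := Measure.smul_finite _ (measure_ne_top _ _)
      have : PolishSpace (principalGroup f) := (isClosed_principalGroup f).polishSpace
      refine ext_of_forall_mem_subalgebra_integral_eq_of_polish
        (separatesPoints_principalCharacterAlgebra f) fun g hg => ?_
      replace hg := mem_span_of_mem_principalCharacterAlgebra hg
      induction hg using Submodule.span_induction with
      | zero => simp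
      | smul a g _ ih => simp only [BoundedContinuousFunction.coe_smul, integral_smul, ih]
      | add g g' _ _ ih ih' =>
        simp only [BoundedContinuousFunction.coe_add, Pi.add_apply]
        rw [integral_add (g.integrable _) (g'.integrable _),
          integral_add (g.integrable _) (g'.integrable _), ih, ih']
      | mem g hg =>
        obtain ⟨h, rfl⟩ := hg
        rw [integral_smul_measure]
        by_cases hh : principalCharacter f h = 1
        · simp [hh, Measure.real]
        · rw [hzero h hh, integral_principalCharacter_eq_zero hh, smul_zero]
    have h0 := congrArg (fun ν : Measure _ => ν sᶜ) hμ
    simp only [Measure.restrict_apply hs.compl, Set.compl_inter_self, measure_empty,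
      Measure.smul_apply, smul_eq_mul] at h0
    rw [Filter.eventuallyConst_set']
    rcases mul_eq_zero.1 h0.symm with h | h
    · exact .inl (ae_eq_empty.2 h)
    · exact .inr (ae_eq_univ.2 h)

end Ergodicity

theorem mainTheorem3 (Γ : Type*) [Group Γ] [Countable Γ] [Infinite Γ]
    (htf : IsTorsionFreeGroup Γ) (hvc : ¬ IsVirtuallyCyclic Γ)
    (hΓ : SatisfiesAnalyticZeroDivisorConjecture Γ) (f : MonoidAlgebra ℤ Γ) :
    ErgodicSMul Γ (principalGroup f) (principalHaar f) := by
  refine ergodicSMul_of_forall_finiteIndex f fun h K hK hh => ?_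
  -- For f = 0 right multiplication is not injective, but the hypothesis on h now reads γh = h,
  -- which forces h = 0.
  by_cases hf : f = 0
  · subst hf
    obtain ⟨γ, hγK, hγ1⟩ := K.bot_or_exists_ne_one.resolve_left fun hbot => by
      subst hbot
      exact hvc ⟨⊥, inferInstance, hK⟩
    obtain ⟨c, hc⟩ := hh γ hγK
    have h0 : h = 0 := eq_zero_of_single_mul_eq (γ := γ) (injective_zpow_iff_not_isOfFinOrder.2
      fun h => hγ1 (htf γ h)) (by rw [← sub_eq_zero, ← hc, mul_zero])
    exact ⟨0, by rw [h0, mul_zero]⟩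
  · exact exists_mul_eq_of_finiteIndex htf hvc hΓ hf K hh
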